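/- Let $(\overline M^{2n+1},\overline\phi,\xi,\eta,\overline g)$ be an indefinite nearly $\mu$-Sasakian manifold ($\mu\in\mathbb R$): $\overline g$ is a semi-Riemannian metric of constant index with Levi-Civita connection $\overline\nabla$; $\overline\phi$, $\xi$, $\eta$ are a smooth $(1,1)$-tensor field, vector field and 1-form with $\overline\phi^2=-I+\eta\otimes\xi$, $\eta(\xi)=1$, $\eta\circ\overline\phi=0$, $\overline\phi\xi=0$, $\overline g(\overline\phi X,\overline\phi Y)=\overline g(X,Y)-\eta(X)\eta(Y)$, $\eta(X)=\overline g(\xi,X)$; and $(\overline\nabla_X\overline\phi)Y+(\overline\nabla_Y\overline\phi)X=\mu\{2\overline g(X,Y)\xi-\eta(Y)X-\eta(X)Y\}$ for all vector fields $X,Y$. Let $(M,g,S(TM),S(TM^\perp))$ be a lightlike submanifold of $\overline M$: $M$ is immersed in $\overline M$ with induced (degenerate) metric $g$; $\mathrm{Rad}\,TM=TM\cap TM^\perp$ is a smooth distribution of rank $r>0$; $S(TM)$ and $S(TM^\perp)$ are nondegenerate smooth complements of $\mathrm{Rad}\,TM$ in $TM$ and in $TM^\perp$, respectively; and $l\mathrm{tr}(TM)$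 is a lightlike transversal bundle, i.e. a totally null smooth rank-$r$ subbundle of $T\overline M|_M$, orthogonal to $S(TM)$ and $S(TM^\perp)$, such that $T\overline M|_M=TM\oplus \mathrm{tr}(TM)$ with $\mathrm{tr}(TM)=l\mathrm{tr}(TM)\perp S(TM^\perp)$. According to $T\overline M|_M=TM\oplus\mathrm{tr}(TM)$ write $\overline\nabla_XY=\nabla_XY+h(X,Y)$ for $X,Y\in\Gamma(TM)$, let $h^s(X,Y)$ be the $S(TM^\perp)$-component of $h(X,Y)$, and for $W\in\Gamma(S(TM^\perp))$ let $-A_WX$ be the $TM$-component of $\overline\nabla_XW$. Suppose that: 1. $M$ is a quasi generalized CR (QGCR) lightlike submanifold: there are smooth distributions $D_1,D_2\subseteq\mathrm{Rad}\,TM$ with $\mathrm{Rad}\,TM=D_1\oplus D_2$, $\overline\phi D_1=D_1$, $\overline\phi D_2\subseteq S(TM)$, and smooth distributions $D_0,\overline D\subseteq S(TM)$ and smooth subbundles $\mathcal S\subseteq S(TM^\perp)$, $\mathcal L\subseteq l\mathrm{tr}(TM)$ with $S(TM)=(\overline\phi D_2+\overline D)\perp D_0$ (the sum $\overline\phi D_2+\overline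 D$ need not be direct), $D_0$ nondegenerate, $\overline\phi D_0\subseteq D_0$ and $\overline D=\overline\phi\mathcal S\oplus\overline\phi\mathcal L$; 2. $M$ is ascreen: along $M$, $\xi$ is a section of $\mathrm{Rad}\,TM\oplus l\mathrm{tr}(TM)$; 3. $M$ is irrotational: $\overline\nabla_XE\in\Gamma(TM)$ for all $X\in\Gamma(TM)$ and $E\in\Gamma(\mathrm{Rad}\,TM)$; 4. the induced connection $\nabla$ is a metric connection, i.e. $\nabla g=0$; 5. $\mathrm{trace}(A_{W_\alpha})|_{S(TM)}=0$ for all $\alpha$, where $(W_\alpha)$ is a local orthonormal frame of $S(TM^\perp)$ (one such frame around each point) and the trace on $S(TM)$ is that of $P\circ A_{W_\alpha}$, $P:TM\to S(TM)$ being the projection along $\mathrm{Rad}\,TM$; that is, $\sum_i\epsilon_i\,g(A_{W_\alpha}X_i,X_i)=0$ for orthonormal bases $(X_i)$ of $S(TM)$, $\epsilon_i=g(X_i,X_i)=\pm1$. Then $M$ is minimal: $h^s(X,Y)=0$ for all $X,Y\in\Gamma(\mathrm{Rad}\,TM)$, and $\mathrm{trace}(h)|_{S(TM)}=\sum_i\epsilon_i\,h(X_i,X_i)=0$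 for orthonormal bases $(X_i)$ of $S(TM)$. -/

import Mathlib

open Bundle
open scoped Manifold ContDiff

namespace LightlikeGeometry

noncomputable section

/-! Throughout, `A` is a `d`-dimensional smooth manifold (the ambient manifold), `M` is an
`m`-dimensional smooth manifold, and `f : M → A` is an immersion. Sections are local: they are
functions which are only required to be smooth on some open set `U`. -/

/-- The model vector space `ℝᵈ`. -/
abbrev Model (d : ℕ) : Type := EuclideanSpace ℝ (Fin d)

/-- `v` is a basis of the subspace `D`. -/
def IsBasisOf {V : Type*} [AddCommGroup V] [Module ℝ V] {k : ℕ} (v : Fin k → V)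
    (D : Submodule ℝ V) : Prop :=
  LinearIndependent ℝ v ∧ Submodule.span ℝ (Set.range v) = D

/-! ### Sections and subbundles -/

section Sections

variable {d m : ℕ}
  {A : Type*} [TopologicalSpace A] [ChartedSpace (Model d) A] [IsManifold (𝓡 d) ∞ A]
  {M : Type*} [TopologicalSpace M] [ChartedSpace (Model m) M] [IsManifold (𝓡 m) ∞ M]

/-- `X` is a smooth vector field on the set `U`. -/
def SmoothField (U : Set A) (X : ∀ p : A, TangentSpace (𝓡 d) p) : Prop :=
  ContMDiffOn (𝓡 d) (𝓡 d).tangent ∞ (fun p ↦ (⟨p, X p⟩ : TangentBundle (𝓡 d) A)) U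

/-- `V` is a smooth section of the pullback bundle `f^* TA` on the set `U ⊆ M`, i.e. a smooth
vector field along `f`. -/
def SmoothAlong (f : M → A) (U : Set M) (V : ∀ q : M, TangentSpace (𝓡 d) (f q)) : Prop :=
  ContMDiffOn (𝓡 m) (𝓡 d).tangent ∞ (fun q ↦ (⟨f q, V q⟩ : TangentBundle (𝓡 d) A)) U

/-- `D` is a smooth distribution of rank `k` on `M` (a rank `k` subbundle of `TM`). -/
def IsDistribution (k : ℕ) (D : ∀ q : M, Submodule ℝ (TangentSpace (𝓡 m) q)) : Prop :=
  ∀ q₀ : M, ∃ U : Set M, IsOpen U ∧ q₀ ∈ U ∧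
    ∃ X : Fin k → ∀ q : M, TangentSpace (𝓡 m) q,
      (∀ i, SmoothField U (X i)) ∧ ∀ q ∈ U, IsBasisOf (fun i ↦ X i q) (D q)

/-- `D` is a smooth rank `k` subbundle of `f^* TA`. -/
def IsSubbundleAlong (f : M → A) (k : ℕ)
    (D : ∀ q : M, Submodule ℝ (TangentSpace (𝓡 d) (f q))) : Prop :=
  ∀ q₀ : M, ∃ U : Set M, IsOpen U ∧ q₀ ∈ U ∧
    ∃ V : Fin k → ∀ q : M, TangentSpace (𝓡 d) (f q),
      (∀ i, SmoothAlong (m := m) f U (V i)) ∧ ∀ q ∈ U, IsBasisOf (fun i ↦ V i q) (D q)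

end Sections

/-! ### The ambient geometry -/

/-- A smooth semi-Riemannian metric of constant index. -/
structure SemiRiemannianMetric (d : ℕ) (A : Type*) [TopologicalSpace A]
    [ChartedSpace (Model d) A] [IsManifold (𝓡 d) ∞ A] where
  inner (p : A) : TangentSpace (𝓡 d) p →L[ℝ] TangentSpace (𝓡 d) p →L[ℝ] ℝ
  symm (p : A) (v w : TangentSpace (𝓡 d) p) : inner p v w = inner p w v
  nondegenerate (p : A) (v : TangentSpace (𝓡 d) p) : (∀ w, inner p v w = 0) → v = 0
  /-- The index: the largest dimension of a negative definite subspace. -/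
  index : ℕ
  isGreatest_index (p : A) :
    IsGreatest {k : ℕ | ∃ V : Submodule ℝ (TangentSpace (𝓡 d) p),
      Module.finrank ℝ V = k ∧ ∀ v ∈ V, v ≠ 0 → inner p v v < 0} index
  contMDiff : ContMDiff (𝓡 d) ((𝓡 d).prod 𝓘(ℝ, Model d →L[ℝ] Model d →L[ℝ] ℝ)) ∞
    (fun p ↦ TotalSpace.mk' (Model d →L[ℝ] Model d →L[ℝ] ℝ)
      (E := fun p : A ↦ TangentSpace (𝓡 d) p →L[ℝ] TangentSpace (𝓡 d) p →L[ℝ] ℝ) p (inner p))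

section Ambient

variable {d : ℕ} {A : Type*} [TopologicalSpace A] [ChartedSpace (Model d) A]
  [IsManifold (𝓡 d) ∞ A]

/-- `nabla` is the Levi-Civita connection of `g`: it is torsion-free and metric. Here
`nabla Y p (X p)` is `∇_X Y` at `p`. -/
structure IsLeviCivita (g : SemiRiemannianMetric d A)
    (nabla : CovariantDerivative (𝓡 d) (Model d) (TangentSpace (𝓡 d) : A → Type _)) : Prop where
  torsion_free {U : Set A} (hU : IsOpen U) {X Y : ∀ p : A, TangentSpace (𝓡 d) p}
    (hX : SmoothField U X) (hY : SmoothField U Y) {p : A} (hp : p ∈ U) :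
    nabla Y p (X p) - nabla X p (Y p) = VectorField.mlieBracket (𝓡 d) X Y p
  metric {U : Set A} (hU : IsOpen U) {Y Z : ∀ p : A, TangentSpace (𝓡 d) p}
    (hY : SmoothField U Y) (hZ : SmoothField U Z) {p : A} (hp : p ∈ U)
    (x : TangentSpace (𝓡 d) p) :
    mvfderiv (𝓡 d) (fun q ↦ g.inner q (Y q) (Z q)) p x =
      g.inner p (nabla Y p x) (Z p) + g.inner p (Y p) (nabla Z p x)

/-- An indefinite almost contact metric structure `(φ, ξ, η, g)` for the metric `g`. -/
structure AlmostContactMetric (g : SemiRiemannianMetric d A) where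
  φ (p : A) : TangentSpace (𝓡 d) p →L[ℝ] TangentSpace (𝓡 d) p
  ξ (p : A) : TangentSpace (𝓡 d) p
  η (p : A) : TangentSpace (𝓡 d) p →L[ℝ] ℝ
  contMDiff_φ : ContMDiff (𝓡 d) ((𝓡 d).prod 𝓘(ℝ, Model d →L[ℝ] Model d)) ∞
    (fun p ↦ TotalSpace.mk' (Model d →L[ℝ] Model d)
      (E := fun p : A ↦ TangentSpace (𝓡 d) p →L[ℝ] TangentSpace (𝓡 d) p) p (φ p))
  smooth_ξ : SmoothField Set.univ ξ
  contMDiff_η : ContMDiff (𝓡 d) ((𝓡 d).prod 𝓘(ℝ, Model d →L[ℝ] ℝ)) ∞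
    (fun p ↦ TotalSpace.mk' (Model d →L[ℝ] ℝ)
      (E := fun p : A ↦ TangentSpace (𝓡 d) p →L[ℝ] ℝ) p (η p))
  φ_φ (p : A) (v : TangentSpace (𝓡 d) p) : φ p (φ p v) = -v + η p v • ξ p
  η_ξ (p : A) : η p (ξ p) = 1
  η_φ (p : A) (v : TangentSpace (𝓡 d) p) : η p (φ p v) = 0
  φ_ξ (p : A) : φ p (ξ p) = 0
  inner_φ_φ (p : A) (v w : TangentSpace (𝓡 d) p) :
    g.inner p (φ p v) (φ p w) = g.inner p v w - η p v * η p w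
  η_eq (p : A) (v : TangentSpace (𝓡 d) p) : η p v = g.inner p (ξ p) v

/-- The covariant derivative `(∇_x φ) Y = ∇_x (φ Y) - φ (∇_x Y)` at `p`. -/
def AlmostContactMetric.nablaPhi {g : SemiRiemannianMetric d A} (S : AlmostContactMetric g)
    (nabla : CovariantDerivative (𝓡 d) (Model d) (TangentSpace (𝓡 d) : A → Type _))
    (Y : ∀ p : A, TangentSpace (𝓡 d) p) (p : A) (x : TangentSpace (𝓡 d) p) :
    TangentSpace (𝓡 d) p :=
  nabla (fun q ↦ S.φ q (Y q)) p x - S.φ p (nabla Y p x)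

/-- The nearly `μ`-Sasakian condition
`(∇_X φ) Y + (∇_Y φ) X = μ (2 g(X, Y) ξ - η(Y) X - η(X) Y)`. -/
def IsNearlySasakian {g : SemiRiemannianMetric d A} (S : AlmostContactMetric g)
    (nabla : CovariantDerivative (𝓡 d) (Model d) (TangentSpace (𝓡 d) : A → Type _))
    (μ : ℝ) : Prop :=
  ∀ (U : Set A), IsOpen U → ∀ X Y : ∀ p : A, TangentSpace (𝓡 d) p,
    SmoothField U X → SmoothField U Y → ∀ p ∈ U,
      S.nablaPhi nabla Y p (X p) + S.nablaPhi nabla X p (Y p) =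
        μ • ((2 * g.inner p (X p) (Y p)) • S.ξ p - S.η p (Y p) • X p - S.η p (X p) • Y p)

end Ambient

/-! ### The ambient connection along an immersion -/

section Along

variable {d m : ℕ}
  {A : Type*} [TopologicalSpace A] [ChartedSpace (Model d) A] [IsManifold (𝓡 d) ∞ A]
  {M : Type*} [TopologicalSpace M] [ChartedSpace (Model m) M] [IsManifold (𝓡 m) ∞ M]

/-- The covariant derivative `∇_x V` (at `p`, in the direction `x ∈ T_p M`) of a vector field `V`
along `f : M → A`, i.e. the pullback connection on `f^* TA`. In the trivialization `e` of `TA`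
centred at `f p`, write `V q = ∑ uⁱ(q) eᵢ(f q)`; then `∇_x V = ∑ duⁱ(x) eᵢ + ∑ uⁱ(p) ∇_{df x} eᵢ`,
and `∑ uⁱ(p) eᵢ` is the extension of `V p` to a vector field which is constant in `e`. -/
def covAlong (nabla : CovariantDerivative (𝓡 d) (Model d) (TangentSpace (𝓡 d) : A → Type _))
    (f : M → A) (V : ∀ q : M, TangentSpace (𝓡 d) (f q)) (p : M) :
    TangentSpace (𝓡 m) p →L[ℝ] TangentSpace (𝓡 d) (f p) :=
  ((trivializationAt (Model d) (TangentSpace (𝓡 d) : A → Type _) (f p)).symmL ℝ (f p)) ∘L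
      mvfderiv (𝓡 m)
        (fun q ↦ (trivializationAt (Model d) (TangentSpace (𝓡 d) : A → Type _) (f p)
          ⟨f q, V q⟩).2) p
    + (nabla (FiberBundle.extend (Model d) (V p)) (f p)) ∘L mfderiv (𝓡 m) (𝓡 d) f p

end Along

/-! ### Lightlike submanifolds -/

section Lightlike

variable {d : ℕ} {A : Type*} [TopologicalSpace A] [ChartedSpace (Model d) A]
  [IsManifold (𝓡 d) ∞ A]

/-- The differential of `f` as a linear map `T_p M → T_{f p} A`. -/
def dMap {m : ℕ} {M : Type*} [TopologicalSpace M] [ChartedSpace (Model m) M]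
    (f : M → A) (p : M) : TangentSpace (𝓡 m) p →ₗ[ℝ] TangentSpace (𝓡 d) (f p) :=
  (mfderiv (𝓡 m) (𝓡 d) f p).toLinearMap

/-- The orthogonal complement `T_p M^⊥ ⊆ T_{f p} A` of (the image of) `T_p M`. -/
def normalSpace {m : ℕ} {M : Type*} [TopologicalSpace M] [ChartedSpace (Model m) M]
    (g : SemiRiemannianMetric d A) (f : M → A) (p : M) :
    Submodule ℝ (TangentSpace (𝓡 d) (f p)) where
  carrier := {v | ∀ x : TangentSpace (𝓡 m) p, g.inner (f p) (dMap (d := d) (m := m) f p x) v = 0}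
  add_mem' := by
    intro a b ha hb x
    rw [map_add, ha x, hb x, add_zero]
  zero_mem' := by
    intro x
    exact map_zero _
  smul_mem' := by
    intro c a ha x
    rw [map_smul, ha x, smul_zero]

/-- The radical `Rad T_p M = T_p M ∩ T_p M^⊥`, as a subspace of `T_p M`. -/
def radical {m : ℕ} {M : Type*} [TopologicalSpace M] [ChartedSpace (Model m) M]
    (g : SemiRiemannianMetric d A) (f : M → A) (p : M) :
    Submodule ℝ (TangentSpace (𝓡 m) p) :=
  (normalSpace (m := m) g f p).comap (dMap (d := d) (m := m) f p)

/-- A lightlike submanifold `(M, g, S(TM), S(TM^⊥))` of `(A, g)`, immersed by `f`, together with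
a lightlike transversal bundle `ltr(TM)`. Distributions on `M` are subspaces of `T_p M`, and
transversal bundles are subspaces of `T_{f p} A`. -/
structure LightlikeSubmanifold (g : SemiRiemannianMetric d A) (m : ℕ) (M : Type*)
    [TopologicalSpace M] [ChartedSpace (Model m) M] [IsManifold (𝓡 m) ∞ M] where
  f : M → A
  contMDiff_f : ContMDiff (𝓡 m) (𝓡 d) ∞ f
  immersion (p : M) : Function.Injective (dMap (d := d) (m := m) f p)
  r : ℕ
  r_pos : 0 < r
  isDistribution_radical : IsDistribution r (radical (m := m) g f)
  /-- The screen distribution `S(TM)`. -/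
  screen (p : M) : Submodule ℝ (TangentSpace (𝓡 m) p)
  isDistribution_screen : ∃ k, IsDistribution k screen
  screen_nondegenerate (p : M) : ∀ x ∈ screen p,
    (∀ y ∈ screen p,
      g.inner (f p) (dMap (d := d) (m := m) f p x) (dMap (d := d) (m := m) f p y) = 0) → x = 0
  isCompl_screen (p : M) : IsCompl (screen p) (radical (m := m) g f p)
  /-- The screen transversal bundle `S(TM^⊥)`. -/
  screenTr (p : M) : Submodule ℝ (TangentSpace (𝓡 d) (f p))
  isSubbundle_screenTr : ∃ k, IsSubbundleAlong (m := m) f k screenTr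
  screenTr_nondegenerate (p : M) : ∀ v ∈ screenTr p,
    (∀ w ∈ screenTr p, g.inner (f p) v w = 0) → v = 0
  disjoint_screenTr (p : M) :
    Disjoint ((radical (m := m) g f p).map (dMap (d := d) (m := m) f p)) (screenTr p)
  sup_screenTr (p : M) :
    (radical (m := m) g f p).map (dMap (d := d) (m := m) f p) ⊔ screenTr p =
      normalSpace (m := m) g f p
  /-- The lightlike transversal bundle `ltr(TM)`: a totally null rank `r` subbundle of the
  orthogonal complement of `S(TM) ⊥ S(TM^⊥)` such that `tr(TM) = ltr(TM) ⊥ S(TM^⊥)` is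
  complementary to `TM`. As `g` is nondegenerate, these conditions say precisely that `g` pairs
  `Rad TM` and `ltr(TM)` perfectly, i.e. every local frame `(Eᵢ)` of `Rad TM` has a dual null
  frame `(Nᵢ)` of `ltr(TM)`. -/
  ltr (p : M) : Submodule ℝ (TangentSpace (𝓡 d) (f p))
  isSubbundle_ltr : IsSubbundleAlong (m := m) f r ltr
  ltr_null (p : M) : ∀ v ∈ ltr p, ∀ w ∈ ltr p, g.inner (f p) v w = 0
  ltr_screen (p : M) : ∀ v ∈ ltr p, ∀ x ∈ screen p,
    g.inner (f p) v (dMap (d := d) (m := m) f p x) = 0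
  ltr_screenTr (p : M) : ∀ v ∈ ltr p, ∀ w ∈ screenTr p, g.inner (f p) v w = 0
  isCompl_tr (p : M) : IsCompl (LinearMap.range (dMap (d := d) (m := m) f p)) (ltr p ⊔ screenTr p)

namespace LightlikeSubmanifold

variable {g : SemiRiemannianMetric d A} {m : ℕ} {M : Type*}
  [TopologicalSpace M] [ChartedSpace (Model m) M] [IsManifold (𝓡 m) ∞ M]

/-- The differential of the immersion, `T_p M → T_{f p} A`. -/
abbrev df (L : LightlikeSubmanifold g m M) (p : M) :
    TangentSpace (𝓡 m) p →ₗ[ℝ] TangentSpace (𝓡 d) (L.f p) :=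
  dMap (d := d) (m := m) L.f p

/-- The radical distribution `Rad TM`. -/
abbrev rad (L : LightlikeSubmanifold g m M) (p : M) : Submodule ℝ (TangentSpace (𝓡 m) p) :=
  radical (m := m) g L.f p

theorem disjoint_ltr_screenTr (L : LightlikeSubmanifold g m M) (p : M) :
    Disjoint (L.ltr p) (L.screenTr p) := by
  rw [Submodule.disjoint_def]
  intro v hv hw
  exact L.screenTr_nondegenerate p v hw fun w hw' ↦ L.ltr_screenTr p v hv w hw'

/-- The decomposition `T_{f p} A = S(TM^⊥) ⊕ (TM ⊕ ltr(TM))`. -/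
theorem isCompl_screenTr (L : LightlikeSubmanifold g m M) (p : M) :
    IsCompl (L.screenTr p) (LinearMap.range (L.df p) ⊔ L.ltr p) := by
  refine ⟨?_, ?_⟩
  · have h := (L.disjoint_ltr_screenTr p).disjoint_sup_left_of_disjoint_sup_right
      (L.isCompl_tr p).disjoint
    exact h.symm
  · have h := (L.isCompl_tr p).codisjoint
    rw [codisjoint_iff] at h ⊢
    rw [← h]
    ac_rfl

/-- The tangential part `T_{f p} A → T_p M` along `tr(TM)`. -/
def tangentPart (L : LightlikeSubmanifold g m M) (p : M) :
    TangentSpace (𝓡 d) (L.f p) →ₗ[ℝ] TangentSpace (𝓡 m) p :=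
  (LinearEquiv.ofInjective (L.df p) (L.immersion p)).symm.toLinearMap ∘ₗ
    (LinearMap.range (L.df p)).projectionOnto (L.ltr p ⊔ L.screenTr p) (L.isCompl_tr p)

variable (nabla : CovariantDerivative (𝓡 d) (Model d) (TangentSpace (𝓡 d) : A → Type _))

/-- `∇̄_x Y ∈ T_{f p} A` for `x ∈ T_p M` and a vector field `Y` on `M`. -/
def ambientCov (L : LightlikeSubmanifold g m M) (Y : ∀ q : M, TangentSpace (𝓡 m) q) (p : M)
    (x : TangentSpace (𝓡 m) p) : TangentSpace (𝓡 d) (L.f p) :=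
  covAlong nabla L.f (fun q ↦ L.df q (Y q)) p x

/-- The induced connection `∇_x Y`, the tangential part of `∇̄_x Y`. -/
def inducedCov (L : LightlikeSubmanifold g m M) (Y : ∀ q : M, TangentSpace (𝓡 m) q) (p : M)
    (x : TangentSpace (𝓡 m) p) : TangentSpace (𝓡 m) p :=
  L.tangentPart p (L.ambientCov nabla Y p x)

/-- The second fundamental form `h(x, Y)`, the transversal part of `∇̄_x Y`. -/
def secondForm (L : LightlikeSubmanifold g m M) (Y : ∀ q : M, TangentSpace (𝓡 m) q) (p : M)
    (x : TangentSpace (𝓡 m) p) : TangentSpace (𝓡 d) (L.f p) :=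
  L.ambientCov nabla Y p x - L.df p (L.inducedCov nabla Y p x)

/-- The screen second fundamental form `h^s(x, Y)`, the component of `h(x, Y)` in `S(TM^⊥)`. -/
def screenSecondForm (L : LightlikeSubmanifold g m M) (Y : ∀ q : M, TangentSpace (𝓡 m) q)
    (p : M) (x : TangentSpace (𝓡 m) p) : L.screenTr p :=
  (L.screenTr p).projectionOnto _ (L.isCompl_screenTr p) (L.secondForm nabla Y p x)

/-- The shape operator `A_W : T_p M → T_p M` of a section `W` of `S(TM^⊥)`; `-A_W x` is the
tangential part of `∇̄_x W`. -/
def shapeOp (L : LightlikeSubmanifold g m M) (W : ∀ q : M, TangentSpace (𝓡 d) (L.f q)) (p : M) :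
    TangentSpace (𝓡 m) p →ₗ[ℝ] TangentSpace (𝓡 m) p :=
  -(L.tangentPart p ∘ₗ (covAlong nabla L.f W p).toLinearMap)

/-- `trace(A_W)|_{S(TM)}` at `p`: the trace of the endomorphism `P ∘ A_W` of `S(TM)`, with
`P : TM → S(TM)` the projection along `Rad TM`. In terms of an orthonormal basis `(Xᵢ)` of
`S(TM)`, with `εᵢ = g(Xᵢ, Xᵢ)`, it is `∑ εᵢ g(A_W Xᵢ, Xᵢ)`. -/
def screenTraceShape (L : LightlikeSubmanifold g m M)
    (W : ∀ q : M, TangentSpace (𝓡 d) (L.f q)) (p : M) : ℝ :=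
  LinearMap.trace ℝ (L.screen p)
    ((L.screen p).projectionOnto _ (L.isCompl_screen p) ∘ₗ L.shapeOp nabla W p ∘ₗ
      (L.screen p).subtype)

/-- `v` is an orthonormal basis of the subspace `D` of `T_{f p} A`: distinct vectors are
orthogonal and each `g(vᵢ, vᵢ)` is `1` or `-1`. -/
def IsOrthonormalBasisOf (L : LightlikeSubmanifold g m M) (p : M) {k : ℕ}
    (v : Fin k → TangentSpace (𝓡 d) (L.f p)) (D : Submodule ℝ (TangentSpace (𝓡 d) (L.f p))) :
    Prop :=
  IsBasisOf v D ∧ (∀ i j, i ≠ j → g.inner (L.f p) (v i) (v j) = 0) ∧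
    ∀ i, g.inner (L.f p) (v i) (v i) = 1 ∨ g.inner (L.f p) (v i) (v i) = -1

/-- `(Wα)` is a local orthonormal frame of `S(TM^⊥)` over `U`. -/
def IsScreenTrFrame (L : LightlikeSubmanifold g m M) (U : Set M) {k : ℕ}
    (W : Fin k → ∀ q : M, TangentSpace (𝓡 d) (L.f q)) : Prop :=
  (∀ α, SmoothAlong (m := m) L.f U (W α)) ∧
    ∀ q ∈ U, L.IsOrthonormalBasisOf q (fun α ↦ W α q) (L.screenTr q)

/-- `trace(A_{Wα})|_{S(TM)} = 0`: around every point there is a local orthonormal frame `(Wα)` of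
`S(TM^⊥)` all of whose shape operators have trace zero on `S(TM)`. -/
def ScreenTraceFree (L : LightlikeSubmanifold g m M) : Prop :=
  ∀ q₀ : M, ∃ U : Set M, IsOpen U ∧ q₀ ∈ U ∧
    ∃ (k : ℕ) (W : Fin k → ∀ q : M, TangentSpace (𝓡 d) (L.f q)), L.IsScreenTrFrame U W ∧
      ∀ q ∈ U, ∀ α, L.screenTraceShape nabla (W α) q = 0

/-- `M` is irrotational: `∇̄_X E ∈ Γ(TM)` for all `X ∈ Γ(TM)` and `E ∈ Γ(Rad TM)`. -/
def IsIrrotational (L : LightlikeSubmanifold g m M) : Prop :=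
  ∀ U : Set M, IsOpen U → ∀ E : ∀ q : M, TangentSpace (𝓡 m) q, SmoothField U E →
    (∀ q ∈ U, E q ∈ L.rad q) → ∀ p ∈ U, ∀ x : TangentSpace (𝓡 m) p,
      L.ambientCov nabla E p x ∈ LinearMap.range (L.df p)

/-- The induced connection `∇` is a metric connection: `∇ g = 0` for the induced (degenerate)
metric `g(Y, Z) = g(df Y, df Z)` on `M`. -/
def InducedCovIsMetric (L : LightlikeSubmanifold g m M) : Prop :=
  ∀ U : Set M, IsOpen U → ∀ Y Z : ∀ q : M, TangentSpace (𝓡 m) q, SmoothField U Y →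
    SmoothField U Z → ∀ p ∈ U, ∀ x : TangentSpace (𝓡 m) p,
      mvfderiv (𝓡 m) (fun q ↦ g.inner (L.f q) (L.df q (Y q)) (L.df q (Z q))) p x =
        g.inner (L.f p) (L.df p (L.inducedCov nabla Y p x)) (L.df p (Z p)) +
        g.inner (L.f p) (L.df p (Y p)) (L.df p (L.inducedCov nabla Z p x))

/-- `M` is minimal: `h^s = 0` on `Rad TM`, and the trace of `h` with respect to `g` restricted to
`S(TM)` vanishes, i.e. `∑ εᵢ h(Xᵢ, Xᵢ) = 0` for orthonormal bases `(Xᵢ)` of `S(TM)`, with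
`εᵢ = g(Xᵢ, Xᵢ)`. -/
structure IsMinimal (L : LightlikeSubmanifold g m M) : Prop where
  screenSecondForm_radical (U : Set M) (hU : IsOpen U) (E : ∀ q : M, TangentSpace (𝓡 m) q)
    (hE : SmoothField U E) (hE' : ∀ q ∈ U, E q ∈ L.rad q) (p : M) (hp : p ∈ U)
    (x : TangentSpace (𝓡 m) p) (hx : x ∈ L.rad p) :
    L.screenSecondForm nabla E p x = 0
  trace_secondForm (U : Set M) (hU : IsOpen U) (k : ℕ)
    (X : Fin k → ∀ q : M, TangentSpace (𝓡 m) q) (hX : ∀ i, SmoothField U (X i))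
    (p : M) (hp : p ∈ U)
    (hXp : L.IsOrthonormalBasisOf p (fun i ↦ L.df p (X i p))
      ((L.screen p).map (L.df p))) :
    ∑ i, g.inner (L.f p) (L.df p (X i p)) (L.df p (X i p)) •
      L.secondForm nabla (X i) p (X i p) = 0

/-- The image of a tangential distribution `D` in `f^* TA`. -/
def push (L : LightlikeSubmanifold g m M) (D : ∀ p : M, Submodule ℝ (TangentSpace (𝓡 m) p))
    (p : M) : Submodule ℝ (TangentSpace (𝓡 d) (L.f p)) :=
  (D p).map (L.df p)

/-- The image of a subbundle `D` of `f^* TA` under `φ`. -/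
def phiImage {g : SemiRiemannianMetric d A} (S : AlmostContactMetric g)
    (L : LightlikeSubmanifold g m M)
    (D : ∀ p : M, Submodule ℝ (TangentSpace (𝓡 d) (L.f p))) (p : M) :
    Submodule ℝ (TangentSpace (𝓡 d) (L.f p)) :=
  (D p).map (S.φ (L.f p)).toLinearMap

/-- Quasi generalized CR (QGCR) lightlike submanifolds. The sum of `φ D₂` and `D̄` need not be
direct: if `ξ` is a section of `D₂ ⊕ 𝓛`, then `φ D₂` and `φ 𝓛 ⊆ D̄` intersect. -/
def IsQGCR (S : AlmostContactMetric g) (L : LightlikeSubmanifold g m M) : Prop :=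
  ∃ (D₁ D₂ D₀ Dbar : ∀ p : M, Submodule ℝ (TangentSpace (𝓡 m) p))
    (Ssub Lsub : ∀ p : M, Submodule ℝ (TangentSpace (𝓡 d) (L.f p))),
    (∃ k, IsDistribution k D₁) ∧ (∃ k, IsDistribution k D₂) ∧ (∃ k, IsDistribution k D₀) ∧
    (∃ k, IsDistribution k Dbar) ∧
    (∃ k, IsSubbundleAlong (m := m) L.f k Ssub) ∧ (∃ k, IsSubbundleAlong (m := m) L.f k Lsub) ∧
    (∀ p, Ssub p ≤ L.screenTr p) ∧ (∀ p, Lsub p ≤ L.ltr p) ∧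
    -- `Rad TM = D₁ ⊕ D₂`, `φ D₁ = D₁`, `φ D₂ ⊆ S(TM)`
    (∀ p, Disjoint (D₁ p) (D₂ p) ∧ D₁ p ⊔ D₂ p = L.rad p) ∧
    (∀ p, L.phiImage S (L.push D₁) p = L.push D₁ p) ∧
    (∀ p, L.phiImage S (L.push D₂) p ≤ L.push L.screen p) ∧
    -- `S(TM) = (φ D₂ + D̄) ⊥ D₀` with `D₀` nondegenerate and `φ D₀ ⊆ D₀`
    (∀ p, (L.phiImage S (L.push D₂) p ⊔ L.push Dbar p) ⊔ L.push D₀ p = L.push L.screen p) ∧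
    (∀ p, ∀ v ∈ L.phiImage S (L.push D₂) p ⊔ L.push Dbar p, ∀ w ∈ L.push D₀ p,
      g.inner (L.f p) v w = 0) ∧
    (∀ p, ∀ v ∈ L.push D₀ p, (∀ w ∈ L.push D₀ p, g.inner (L.f p) v w = 0) → v = 0) ∧
    (∀ p, L.phiImage S (L.push D₀) p ≤ L.push D₀ p) ∧
    -- `D̄ = φ 𝓢 ⊕ φ 𝓛`
    (∀ p, Disjoint (L.phiImage S Ssub p) (L.phiImage S Lsub p)) ∧
    (∀ p, L.push Dbar p = L.phiImage S Ssub p ⊔ L.phiImage S Lsub p)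

/-- `M` is ascreen: the structure vector field `ξ` belongs to `Rad TM ⊕ ltr(TM)`. -/
def IsAscreen (S : AlmostContactMetric g) (L : LightlikeSubmanifold g m M) : Prop :=
  ∀ p, S.ξ (L.f p) ∈ L.push L.rad p ⊔ L.ltr p

end LightlikeSubmanifold

end Lightlike

end

end LightlikeGeometry

open Bundle
open scoped Manifold ContDiff

namespace LightlikeGeometry

/-! The form `h` is transversal, and by nondegeneracy of the ambient metric a transversal vector
vanishes once it is orthogonal to `Rad TM` and to `S(TM^⊥)` (`eq_zero_of_mem_tr`). So minimality
reduces to two kinds of pairing.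

Pairing with `Rad TM`: let `E` be a radical section. Irrotationality makes `∇̄_x E` tangent, hence
`h(x, E) = 0`, which is already the first half of minimality. The function `g(Y, E)` is identically
zero; differentiating it once with `∇̄` and once with `∇`, where `∇ g = 0`, and subtracting leaves
`g(h(x, Y), E) = 0` (`inner_rad_secondForm`).

Pairing with `S(TM^⊥)`: differentiating `g(Y, W) = 0` gives `g(h(x, Y), W) = g(A_W x, Y)` for `Y` in
the screen (`inner_secondForm_screenTr`). Summed over an orthonormal basis, this is the trace of
`A_W` on `S(TM)`, which vanishes for a suitable frame `(Wα)`, and such a frame spans `S(TM^⊥)`.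

The analytic input is that `∇̄` stays metric on fields along the immersion
(`IsLeviCivita.mvfderiv_inner_along`), although compatibility is given only for fields on the
ambient manifold. -/

/-! ### Calculus: the product rule for a varying bilinear form. -/

/-- The product rule for the evaluation of a bilinear form. -/
theorem mvfderiv_bilinear_apply {m : ℕ} {M : Type*} [TopologicalSpace M]
    [ChartedSpace (Model m) M] {F : Type*} [NormedAddCommGroup F] [NormedSpace ℝ F]
    {B : M → F →L[ℝ] F →L[ℝ] ℝ} {u w : M → F} {p : M}
    (hB : MDifferentiableAt (𝓡 m) 𝓘(ℝ, F →L[ℝ] F →L[ℝ] ℝ) B p)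
    (hu : MDifferentiableAt (𝓡 m) 𝓘(ℝ, F) u p) (hw : MDifferentiableAt (𝓡 m) 𝓘(ℝ, F) w p)
    (x : TangentSpace (𝓡 m) p) :
    mvfderiv (𝓡 m) (fun q ↦ B q (u q) (w q)) p x =
      mvfderiv (𝓡 m) (fun q ↦ B q (u p) (w p)) p x +
        B p (mvfderiv (𝓡 m) u p x) (w p) + B p (u p) (mvfderiv (𝓡 m) w p x) := by
  have key : ∀ {u w : M → F}, MDifferentiableAt (𝓡 m) 𝓘(ℝ, F) u p →
      MDifferentiableAt (𝓡 m) 𝓘(ℝ, F) w p →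
      mvfderiv (𝓡 m) (fun q ↦ B q (u q) (w q)) p x =
        mvfderiv (𝓡 m) B p x (u p) (w p) +
        B p (mvfderiv (𝓡 m) u p x) (w p) + B p (u p) (mvfderiv (𝓡 m) w p x) := by
    intro u w hu hw
    have hs : UniqueDiffWithinAt ℝ (Set.range (𝓡 m)) (extChartAt (𝓡 m) p p) :=
      (𝓡 m).uniqueDiffOn _ (Set.mem_range_self _)
    have hB' := hB.differentiableWithinAt_writtenInExtChartAt
    have hu' := hu.differentiableWithinAt_writtenInExtChartAt
    have hw' := hw.differentiableWithinAt_writtenInExtChartAt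
    have h := ((hB'.hasFDerivWithinAt.clm_apply hu'.hasFDerivWithinAt).clm_apply
      hw'.hasFDerivWithinAt).fderivWithin hs
    rw [((hB.clm_apply hu).clm_apply hw).mvfderiv, hB.mvfderiv, hu.mvfderiv, hw.mvfderiv]
    have hBp : writtenInExtChartAt (𝓡 m) 𝓘(ℝ, F →L[ℝ] F →L[ℝ] ℝ) p B (extChartAt (𝓡 m) p p) =
        B p := by simp [writtenInExtChartAt, chartAt_self_eq]
    have hup : writtenInExtChartAt (𝓡 m) 𝓘(ℝ, F) p u (extChartAt (𝓡 m) p p) = u p := by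
      simp [writtenInExtChartAt, chartAt_self_eq]
    have hwp : writtenInExtChartAt (𝓡 m) 𝓘(ℝ, F) p w (extChartAt (𝓡 m) p p) = w p := by
      simp [writtenInExtChartAt, chartAt_self_eq]
    rw [hBp, hup, hwp] at h
    refine (DFunLike.congr_fun h x).trans ?_
    generalize fderivWithin ℝ (writtenInExtChartAt (𝓡 m) 𝓘(ℝ, F →L[ℝ] F →L[ℝ] ℝ) p B) _ _ = B'
    generalize fderivWithin ℝ (writtenInExtChartAt (𝓡 m) 𝓘(ℝ, F) p u) _ _ = u'
    generalize fderivWithin ℝ (writtenInExtChartAt (𝓡 m) 𝓘(ℝ, F) p w) _ _ = w'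
    change (B p (u p) (w' x) + (B p (u' x) (w p) + B' x (u p) (w p)) : ℝ) =
      B' x (u p) (w p) + B p (u' x) (w p) + B p (u p) (w' x)
    ring
  -- Applying the full product rule also to the constants `u p` and `w p` identifies the term in the
  -- derivative of `B` with the derivative of `B` on frozen arguments.
  rw [key hu hw, key mdifferentiableAt_const mdifferentiableAt_const]
  simp [mvfderiv_const]

/-! ### Metric compatibility of the pullback connection. -/

section Pullback

variable {d m : ℕ}
  {A : Type*} [TopologicalSpace A] [ChartedSpace (Model d) A] [IsManifold (𝓡 d) ∞ A]
  {M : Type*} [TopologicalSpace M] [ChartedSpace (Model m) M]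

/-- The metric in the trivialization of `TA` centred at `a`. -/
noncomputable def localForm (g : SemiRiemannianMetric d A) (a b : A) :
    Model d →L[ℝ] Model d →L[ℝ] ℝ :=
  ContinuousLinearMap.inCoordinates (Model d) (TangentSpace (𝓡 d) : A → Type _)
    (Model d →L[ℝ] ℝ) (fun c : A ↦ TangentSpace (𝓡 d) c →L[ℝ] ℝ) a b a b (g.inner b)

/-- Translates between coordinates and vectors. For fixed `v` and `w`, the right-hand side is the
metric on two fields with constant coordinates, which are the extensions that enter `covAlong`. -/
theorem localForm_apply (g : SemiRiemannianMetric d A) {a b : A}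
    (hb : b ∈ (trivializationAt (Model d) (TangentSpace (𝓡 d) : A → Type _) a).baseSet)
    (v w : Model d) :
    localForm g a b v w =
      g.inner b ((trivializationAt (Model d) (TangentSpace (𝓡 d) : A → Type _) a).symm b v)
        ((trivializationAt (Model d) (TangentSpace (𝓡 d) : A → Type _) a).symm b w) := by
  have := inCoordinates_apply_eq₂ (𝕜 := ℝ) (F₁ := Model d) (F₂ := Model d)
    (F₃ := ℝ) (E₁ := (TangentSpace (𝓡 d) : A → Type _))
    (E₂ := (TangentSpace (𝓡 d) : A → Type _)) (E₃ := Bundle.Trivial A ℝ)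
    (ϕ := g.inner b) (v := v) (w := w) hb hb (Set.mem_univ b)
  exact this.trans (by simp)

theorem contMDiffAt_localForm (g : SemiRiemannianMetric d A) (a : A) :
    ContMDiffAt (𝓡 d) 𝓘(ℝ, Model d →L[ℝ] Model d →L[ℝ] ℝ) ∞ (localForm g a) a := by
  have h := g.contMDiff a
  rw [contMDiffAt_hom_bundle] at h
  exact h.2

end Pullback

section Along

variable {d m : ℕ}
  {A : Type*} [TopologicalSpace A] [ChartedSpace (Model d) A] [IsManifold (𝓡 d) ∞ A]
  {M : Type*} [TopologicalSpace M] [ChartedSpace (Model m) M]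

/-- The pullback of a metric connection along a smooth map is metric. -/
theorem IsLeviCivita.mvfderiv_inner_along {g : SemiRiemannianMetric d A}
    {nabla : CovariantDerivative (𝓡 d) (Model d) (TangentSpace (𝓡 d) : A → Type _)}
    (hLC : IsLeviCivita g nabla) {f : M → A} {U : Set M} (hU : IsOpen U)
    (hf : ContMDiff (𝓡 m) (𝓡 d) ∞ f)
    {V W : ∀ q : M, TangentSpace (𝓡 d) (f q)}
    (hV : SmoothAlong (m := m) f U V) (hW : SmoothAlong (m := m) f U W) {p : M} (hp : p ∈ U)
    (x : TangentSpace (𝓡 m) p) :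
    mvfderiv (𝓡 m) (fun q ↦ g.inner (f q) (V q) (W q)) p x =
      g.inner (f p) (covAlong nabla f V p x) (W p) +
        g.inner (f p) (V p) (covAlong nabla f W p x) := by
  have hVp := (hV.contMDiffAt (hU.mem_nhds hp)).mdifferentiableAt (by simp)
  have hWp := (hW.contMDiffAt (hU.mem_nhds hp)).mdifferentiableAt (by simp)
  have hfp : MDifferentiableAt (𝓡 m) (𝓡 d) f p := hf.mdifferentiable (by simp) p
  have hu := ((mdifferentiableAt_totalSpace _ _).1 hVp).2
  have hw := ((mdifferentiableAt_totalSpace _ _).1 hWp).2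
  have hB : MDifferentiableAt (𝓡 m) 𝓘(ℝ, Model d →L[ℝ] Model d →L[ℝ] ℝ)
      (fun q ↦ localForm g (f p) (f q)) p :=
    MDifferentiableAt.comp p ((contMDiffAt_localForm g (f p)).mdifferentiableAt (by simp)) hfp
  have hmem : f p ∈ (trivializationAt (Model d) (TangentSpace (𝓡 d) : A → Type _) (f p)).baseSet :=
    FiberBundle.mem_baseSet_trivializationAt' (f p)
  have hbase : ∀ᶠ b in nhds (f p),
      b ∈ (trivializationAt (Model d) (TangentSpace (𝓡 d) : A → Type _) (f p)).baseSet :=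
    (trivializationAt (Model d) (TangentSpace (𝓡 d) : A → Type _) (f p)).open_baseSet.mem_nhds hmem
  have h₁ : (fun q ↦ g.inner (f q) (V q) (W q)) =ᶠ[nhds p] fun q ↦ localForm g (f p) (f q)
      (trivializationAt (Model d) (TangentSpace (𝓡 d) : A → Type _) (f p) ⟨f q, V q⟩).2
      (trivializationAt (Model d) (TangentSpace (𝓡 d) : A → Type _) (f p) ⟨f q, W q⟩).2 := by
    filter_upwards [hf.continuous.continuousAt.eventually hbase] with q hq
    rw [localForm_apply g hq, Trivialization.symm_apply_apply_mk _ hq,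
      Trivialization.symm_apply_apply_mk _ hq]
  -- With the coordinates frozen at `p`, the function factors through `f`. Its derivative therefore
  -- comes, by the chain rule, from fields on `A`, where the Levi-Civita property applies.
  have h₂ : (fun q ↦ localForm g (f p) (f q)
      (trivializationAt (Model d) (TangentSpace (𝓡 d) : A → Type _) (f p) ⟨f p, V p⟩).2
      (trivializationAt (Model d) (TangentSpace (𝓡 d) : A → Type _) (f p) ⟨f p, W p⟩).2)
      =ᶠ[nhds p] (fun b ↦ g.inner b (FiberBundle.extend (Model d) (V p) b)
        (FiberBundle.extend (Model d) (W p) b)) ∘ f := by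
    filter_upwards [hf.continuous.continuousAt.eventually hbase] with q hq
    exact localForm_apply g hq _ _
  obtain ⟨s, hs, hVs⟩ := FiberBundle.exists_contMDiffOn_extend (k := ∞) (𝓡 d) (Model d) (V p)
  obtain ⟨t, ht, hWt⟩ := FiberBundle.exists_contMDiffOn_extend (k := ∞) (𝓡 d) (Model d) (W p)
  have hext : MDifferentiableAt (𝓡 d) 𝓘(ℝ, ℝ) (fun b ↦ g.inner b
      (FiberBundle.extend (Model d) (V p) b) (FiberBundle.extend (Model d) (W p) b)) (f p) := by
    refine MDifferentiableAt.congr_of_eventuallyEq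
      ((((contMDiffAt_localForm g (f p)).mdifferentiableAt (by simp)).clm_apply
        (mdifferentiableAt_const
          (c := (trivializationAt (Model d) (TangentSpace (𝓡 d) : A → Type _) (f p) ⟨f p, V p⟩).2))).clm_apply
        (mdifferentiableAt_const
          (c := (trivializationAt (Model d) (TangentSpace (𝓡 d) : A → Type _) (f p) ⟨f p, W p⟩).2))) ?_
    filter_upwards [hbase] with b hb
    exact (localForm_apply g hb _ _).symm
  -- The extensions are known to be smooth only on the neighbourhoods `s` and `t`, while metric
  -- compatibility asks for an open set.
  have h₃ := hLC.metric (U := interior (s ∩ t)) isOpen_interior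
    (hVs.mono (interior_subset.trans Set.inter_subset_left))
    (hWt.mono (interior_subset.trans Set.inter_subset_right))
    (mem_interior_iff_mem_nhds.2 (Filter.inter_mem hs ht)) (mfderiv (𝓡 m) (𝓡 d) f p x)
  simp only [mvfderiv, h₁.mfderiv_eq]
  refine (mvfderiv_bilinear_apply hB hu hw x).trans ?_
  have h₄ : mvfderiv (𝓡 m) (fun q ↦ localForm g (f p) (f q)
      (trivializationAt (Model d) (TangentSpace (𝓡 d) : A → Type _) (f p) ⟨f p, V p⟩).2
      (trivializationAt (Model d) (TangentSpace (𝓡 d) : A → Type _) (f p) ⟨f p, W p⟩).2) p x =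
      mvfderiv (𝓡 d) (fun b ↦ g.inner b (FiberBundle.extend (Model d) (V p) b)
        (FiberBundle.extend (Model d) (W p) b)) (f p) (mfderiv (𝓡 m) (𝓡 d) f p x) := by
    have h := h₂.mfderiv_eq (I := 𝓡 m) (I' := 𝓘(ℝ, ℝ))
    rw [mfderiv_comp p hext hfp] at h
    exact DFunLike.congr_fun h x
  -- The derivatives of the coordinates give the first summand of `covAlong`, and the frozen
  -- extensions give the second.
  rw [h₄, h₃, localForm_apply g hmem, localForm_apply g hmem]
  simp only [covAlong, add_apply, ContinuousLinearMap.comp_apply, map_add,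
    FiberBundle.extend_apply_self, Trivialization.symm_apply_apply_mk _ hmem,
    Trivialization.symmL_apply _ hmem]
  ring

/-- The image of a smooth vector field on `M` is a smooth vector field along `f`. -/
theorem SmoothField.smoothAlong_dMap [IsManifold (𝓡 m) ∞ M] {f : M → A} {U : Set M}
    (hf : ContMDiff (𝓡 m) (𝓡 d) ∞ f) {Y : ∀ q : M, TangentSpace (𝓡 m) q}
    (hY : SmoothField U Y) :
    SmoothAlong (m := m) f U (fun q ↦ dMap (d := d) (m := m) f q (Y q)) :=
  (hf.contMDiff_tangentMap (m := ∞) (by simp)).comp_contMDiffOn hY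

end Along

/-! ### Traces in orthonormal bases, and local sections. -/

/-- The trace of an endomorphism in terms of an orthonormal basis. -/
theorem trace_eq_sum_of_orthonormal {E : Type*} [AddCommGroup E] [Module ℝ E] {k : ℕ}
    (B : E →ₗ[ℝ] E →ₗ[ℝ] ℝ) (b : Module.Basis (Fin k) ℝ E)
    (hb : ∀ i j, i ≠ j → B (b i) (b j) = 0) (hb' : ∀ i, B (b i) (b i) * B (b i) (b i) = 1)
    (T : E →ₗ[ℝ] E) :
    LinearMap.trace ℝ E T = ∑ i, B (b i) (b i) * B (b i) (T (b i)) := by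
  -- The `i`-th coordinate is `εᵢ B(bᵢ, v)`: pairing with `bᵢ` isolates `εᵢ` times the coordinate,
  -- and `εᵢ² = 1`.
  have hrepr : ∀ (v : E) (i : Fin k), b.repr v i = B (b i) (b i) * B (b i) v := by
    intro v i
    conv_rhs => rw [← b.sum_repr v]
    rw [map_sum, Finset.sum_eq_single i (fun j _ hj ↦ by rw [map_smul, hb i j hj.symm, smul_zero])
      (by simp), map_smul, smul_eq_mul, mul_left_comm, hb', mul_one]
  rw [LinearMap.trace_eq_matrix_trace ℝ b, Matrix.trace]
  simp [LinearMap.toMatrix_apply, hrepr]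

/-- The derivative of a function vanishes where the function is locally zero. -/
theorem mvfderiv_eq_zero_of_eqOn {m : ℕ} {M : Type*} [TopologicalSpace M]
    [ChartedSpace (Model m) M] {φ : M → ℝ} {U : Set M} (hU : IsOpen U)
    (h : ∀ q ∈ U, φ q = 0) {p : M} (hp : p ∈ U) : mvfderiv (𝓡 m) φ p = 0 := by
  have h' : φ =ᶠ[nhds p] fun _ ↦ (0 : ℝ) := by
    filter_upwards [hU.mem_nhds hp] with q hq using h q hq
  have h₂ := mvfderiv_const (I := 𝓡 m) (0 : ℝ) (x := p)
  ext x
  rw [mvfderiv, h'.mfderiv_eq]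
  exact DFunLike.congr_fun h₂ x

/-- Around each point, a vector of a distribution extends to a local section. -/
theorem IsDistribution.exists_section {m : ℕ} {M : Type*} [TopologicalSpace M]
    [ChartedSpace (Model m) M] [IsManifold (𝓡 m) ∞ M] {k : ℕ}
    {D : ∀ q : M, Submodule ℝ (TangentSpace (𝓡 m) q)} (hD : IsDistribution k D) {p : M}
    {e : TangentSpace (𝓡 m) p} (he : e ∈ D p) :
    ∃ U : Set M, IsOpen U ∧ p ∈ U ∧ ∃ E : ∀ q : M, TangentSpace (𝓡 m) q,
      SmoothField U E ∧ (∀ q ∈ U, E q ∈ D q) ∧ E p = e := by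
  obtain ⟨U, hU, hp, X, hX, hb⟩ := hD p
  rw [← (hb p hp).2] at he
  obtain ⟨c, hc⟩ := (Submodule.mem_span_range_iff_exists_fun ℝ).1 he
  -- The coefficients of `e` in the local frame at `p` are kept constant.
  refine ⟨U, hU, hp, fun q ↦ ∑ i, c i • X i q, ?_, fun q hq ↦ ?_, hc⟩
  · exact ContMDiffOn.sum_section fun i _ ↦ (hX i).const_smul_section
  · rw [← (hb q hq).2]
    exact Submodule.sum_mem _ fun i _ ↦
      Submodule.smul_mem _ _ (Submodule.subset_span (Set.mem_range_self i))

/-! ### Orthogonality relations in the decomposition of the ambient tangent space. -/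

namespace LightlikeSubmanifold

variable {d : ℕ} {A : Type*} [TopologicalSpace A] [ChartedSpace (Model d) A]
  [IsManifold (𝓡 d) ∞ A] {g : SemiRiemannianMetric d A} {m : ℕ} {M : Type*}
  [TopologicalSpace M] [ChartedSpace (Model m) M] [IsManifold (𝓡 m) ∞ M]

/-- `S(TM^⊥)` is orthogonal to `TM`. -/
theorem inner_df_screenTr (L : LightlikeSubmanifold g m M) (p : M) (x : TangentSpace (𝓡 m) p)
    {w : TangentSpace (𝓡 d) (L.f p)} (hw : w ∈ L.screenTr p) :
    g.inner (L.f p) (L.df p x) w = 0 := by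
  have h : w ∈ normalSpace (m := m) g L.f p := by
    rw [← L.sup_screenTr p]
    exact Submodule.mem_sup_right hw
  exact h x

/-- `Rad TM` is orthogonal to `TM`. -/
theorem inner_df_rad (L : LightlikeSubmanifold g m M) (p : M) (x : TangentSpace (𝓡 m) p)
    {e : TangentSpace (𝓡 m) p} (he : e ∈ L.rad p) :
    g.inner (L.f p) (L.df p x) (L.df p e) = 0 :=
  he x

/-- A vector `v` is the sum of its tangential part and a transversal vector. -/
theorem sub_df_tangentPart_mem (L : LightlikeSubmanifold g m M) (p : M)
    (v : TangentSpace (𝓡 d) (L.f p)) :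
    v - L.df p (L.tangentPart p v) ∈ L.ltr p ⊔ L.screenTr p := by
  have h : L.df p (L.tangentPart p v) =
      (LinearMap.range (L.df p)).projectionOnto _ (L.isCompl_tr p) v :=
    congrArg Subtype.val (LinearEquiv.apply_symm_apply
      (LinearEquiv.ofInjective (L.df p) (L.immersion p))
      ((LinearMap.range (L.df p)).projectionOnto _ (L.isCompl_tr p) v))
  rw [h, ← Submodule.projectionOnto_apply_eq_zero_iff (L.isCompl_tr p), map_sub,
    Submodule.projectionOnto_apply_left, sub_self]

/-- The tangential part of a tangent vector is the vector itself. -/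
theorem df_tangentPart_of_mem_range (L : LightlikeSubmanifold g m M) (p : M)
    {v : TangentSpace (𝓡 d) (L.f p)} (hv : v ∈ LinearMap.range (L.df p)) :
    L.df p (L.tangentPart p v) = v := by
  have h := L.sub_df_tangentPart_mem p v
  have h' : v - L.df p (L.tangentPart p v) ∈ LinearMap.range (L.df p) :=
    Submodule.sub_mem _ hv (LinearMap.mem_range_self _ _)
  exact (sub_eq_zero.1 (Submodule.disjoint_def.1 (L.isCompl_tr p).disjoint _ h' h)).symm

/-- Transversal vectors are orthogonal to `S(TM)`. -/
theorem inner_screen_tr (L : LightlikeSubmanifold g m M) (p : M) {x : TangentSpace (𝓡 m) p}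
    (hx : x ∈ L.screen p) {v : TangentSpace (𝓡 d) (L.f p)} (hv : v ∈ L.ltr p ⊔ L.screenTr p) :
    g.inner (L.f p) (L.df p x) v = 0 := by
  obtain ⟨l, hl, s, hs, rfl⟩ := Submodule.mem_sup.1 hv
  rw [map_add, L.inner_df_screenTr p x hs, g.symm, L.ltr_screen p l hl x hx, add_zero]

/-- A transversal vector which is orthogonal to `Rad TM` and to `S(TM^⊥)` vanishes. -/
theorem eq_zero_of_mem_tr (L : LightlikeSubmanifold g m M) (p : M)
    {v : TangentSpace (𝓡 d) (L.f p)} (hv : v ∈ L.ltr p ⊔ L.screenTr p)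
    (hrad : ∀ e ∈ L.rad p, g.inner (L.f p) (L.df p e) v = 0)
    (htr : ∀ w ∈ L.screenTr p, g.inner (L.f p) v w = 0) : v = 0 := by
  -- Test `v` against each of the four summands. The pairings with `S(TM)` and `ltr(TM)` vanish for
  -- every transversal vector, the latter because `ltr(TM)` is null and orthogonal to `S(TM^⊥)`; the
  -- hypotheses cover the other two.
  refine g.nondegenerate _ v fun w ↦ ?_
  have hw : w ∈ LinearMap.range (L.df p) ⊔ (L.ltr p ⊔ L.screenTr p) := by
    rw [(L.isCompl_tr p).sup_eq_top]
    trivial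
  obtain ⟨_, ⟨x, rfl⟩, t, ht, rfl⟩ := Submodule.mem_sup.1 hw
  obtain ⟨l, hl, s, hs, rfl⟩ := Submodule.mem_sup.1 ht
  have hx : x ∈ L.screen p ⊔ L.rad p := by
    rw [(L.isCompl_screen p).sup_eq_top]
    trivial
  obtain ⟨y, hy, e, he, rfl⟩ := Submodule.mem_sup.1 hx
  have hl' : g.inner (L.f p) v l = 0 := by
    obtain ⟨l', hl', s', hs', rfl⟩ := Submodule.mem_sup.1 hv
    rw [map_add, add_apply, L.ltr_null p l' hl' l hl, g.symm, L.ltr_screenTr p l hl s' hs',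
      add_zero]
  rw [map_add, map_add, map_add, map_add, htr s hs, hl', g.symm _ v (L.df p y),
    g.symm _ v (L.df p e), L.inner_screen_tr p hy hv, hrad e he]
  simp

/-! ### The components of the second fundamental form. -/

variable {nabla : CovariantDerivative (𝓡 d) (Model d) (TangentSpace (𝓡 d) : A → Type _)}

theorem secondForm_mem_tr (L : LightlikeSubmanifold g m M) (Y : ∀ q : M, TangentSpace (𝓡 m) q)
    (p : M) (x : TangentSpace (𝓡 m) p) :
    L.secondForm nabla Y p x ∈ L.ltr p ⊔ L.screenTr p :=
  L.sub_df_tangentPart_mem p _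

/-- If `M` is irrotational, then `h` vanishes on `TM × Rad TM`. -/
theorem IsIrrotational.secondForm_eq_zero {L : LightlikeSubmanifold g m M}
    (hI : L.IsIrrotational nabla) {U : Set M} (hU : IsOpen U)
    {E : ∀ q : M, TangentSpace (𝓡 m) q} (hE : SmoothField U E) (hE' : ∀ q ∈ U, E q ∈ L.rad q)
    {p : M} (hp : p ∈ U) (x : TangentSpace (𝓡 m) p) : L.secondForm nabla E p x = 0 :=
  sub_eq_zero.2 (L.df_tangentPart_of_mem_range p (hI U hU E hE hE' p hp x)).symm

/-- If `M` is irrotational and `∇ g = 0`, then `h` is orthogonal to `Rad TM`, i.e. its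
`ltr(TM)`-component vanishes. -/
theorem inner_rad_secondForm (hLC : IsLeviCivita g nabla) {L : LightlikeSubmanifold g m M}
    (hI : L.IsIrrotational nabla) (hmetric : L.InducedCovIsMetric nabla) {U : Set M}
    (hU : IsOpen U) {Y : ∀ q : M, TangentSpace (𝓡 m) q} (hY : SmoothField U Y) {p : M}
    (hp : p ∈ U) (x : TangentSpace (𝓡 m) p) {e : TangentSpace (𝓡 m) p} (he : e ∈ L.rad p) :
    g.inner (L.f p) (L.df p e) (L.secondForm nabla Y p x) = 0 := by
  -- The vector `e` is extended to a radical section so that `g(Y, E) = 0` holds on an open set and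
  -- can be differentiated.
  obtain ⟨V, hV, hpV, E, hE, hE', rfl⟩ := L.isDistribution_radical.exists_section he
  have hUV : IsOpen (U ∩ V) := hU.inter hV
  have hYV : SmoothField (U ∩ V) Y := hY.mono Set.inter_subset_left
  have hEV : SmoothField (U ∩ V) E := hE.mono Set.inter_subset_right
  have hzero : mvfderiv (𝓡 m) (fun q ↦ g.inner (L.f q) (L.df q (Y q)) (L.df q (E q))) p = 0 :=
    mvfderiv_eq_zero_of_eqOn hUV (fun q hq ↦ L.inner_df_rad q _ (hE' q hq.2)) ⟨hp, hpV⟩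
  have h₁ := hmetric (U ∩ V) hUV Y E hYV hEV p ⟨hp, hpV⟩ x
  have h₂ := hLC.mvfderiv_inner_along hUV L.contMDiff_f (hYV.smoothAlong_dMap L.contMDiff_f)
    (hEV.smoothAlong_dMap L.contMDiff_f) ⟨hp, hpV⟩ x
  -- The terms `g(Y, ∇̄_x E)` and `g(Y, ∇_x E)` thus agree, so the two product rules differ exactly
  -- by `g(h(x, Y), E)`.
  have h₃ : L.ambientCov nabla E p x = L.df p (L.inducedCov nabla E p x) :=
    sub_eq_zero.1 (hI.secondForm_eq_zero hV hE hE' hpV x)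
  rw [hzero] at h₁
  have h₂' : (0 : ℝ) = g.inner (L.f p) (L.ambientCov nabla Y p x) (L.df p (E p)) +
      g.inner (L.f p) (L.df p (Y p)) (L.ambientCov nabla E p x) :=
    (DFunLike.congr_fun hzero x).symm.trans h₂
  rw [h₃] at h₂'
  rw [g.symm, secondForm, map_sub, sub_apply]
  simp only [zero_apply] at h₁
  linarith

/-- The screen second fundamental form and the shape operators of `S(TM^⊥)`:
`g(h(x, Y), W) = g(A_W x, Y)` if `Y` belongs to `S(TM)` at the point in question. -/
theorem inner_secondForm_screenTr (hLC : IsLeviCivita g nabla) (L : LightlikeSubmanifold g m M)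
    {U : Set M} (hU : IsOpen U) {Y : ∀ q : M, TangentSpace (𝓡 m) q} (hY : SmoothField U Y)
    {W : ∀ q : M, TangentSpace (𝓡 d) (L.f q)} (hW : SmoothAlong (m := m) L.f U W)
    (hW' : ∀ q ∈ U, W q ∈ L.screenTr q) {p : M} (hp : p ∈ U) (hYp : Y p ∈ L.screen p)
    (x : TangentSpace (𝓡 m) p) :
    g.inner (L.f p) (L.secondForm nabla Y p x) (W p) =
      g.inner (L.f p) (L.df p (Y p)) (L.df p (L.shapeOp nabla W p x)) := by
  have hzero : mvfderiv (𝓡 m) (fun q ↦ g.inner (L.f q) (L.df q (Y q)) (W q)) p = 0 :=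
    mvfderiv_eq_zero_of_eqOn hU (fun q hq ↦ L.inner_df_screenTr q _ (hW' q hq)) hp
  have h : (0 : ℝ) = g.inner (L.f p) (L.ambientCov nabla Y p x) (W p) +
      g.inner (L.f p) (L.df p (Y p)) (covAlong nabla L.f W p x) :=
    (DFunLike.congr_fun hzero x).symm.trans <|
      hLC.mvfderiv_inner_along hU L.contMDiff_f (hY.smoothAlong_dMap L.contMDiff_f) hW hp x
  -- This is where `Y p` must lie in the screen: for a general tangent vector, the `ltr(TM)`-part of
  -- `∇̄_x W` could contribute through the radical component.
  have h' := L.inner_screen_tr p hYp (L.sub_df_tangentPart_mem p (covAlong nabla L.f W p x))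
  have h'' : L.df p (L.shapeOp nabla W p x) =
      -L.df p (L.tangentPart p (covAlong nabla L.f W p x)) := map_neg _ _
  rw [map_sub] at h'
  rw [h'', map_neg, secondForm, map_sub, sub_apply, L.inner_df_screenTr p _ (hW' p hp)]
  linarith

end LightlikeSubmanifold

/-! ### The trace on the screen distribution, and minimality. -/

namespace LightlikeSubmanifold

variable {d : ℕ} {A : Type*} [TopologicalSpace A] [ChartedSpace (Model d) A]
  [IsManifold (𝓡 d) ∞ A] {g : SemiRiemannianMetric d A} {m : ℕ} {M : Type*}
  [TopologicalSpace M] [ChartedSpace (Model m) M] [IsManifold (𝓡 m) ∞ M]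
  {nabla : CovariantDerivative (𝓡 d) (Model d) (TangentSpace (𝓡 d) : A → Type _)}

/-- Vectors whose images form a basis of the image of `S(TM)` belong to `S(TM)`. -/
theorem mem_screen_of_isBasisOf {L : LightlikeSubmanifold g m M} {p : M} {k : ℕ}
    {X : Fin k → TangentSpace (𝓡 m) p}
    (hX : IsBasisOf (fun i ↦ L.df p (X i)) ((L.screen p).map (L.df p))) (i : Fin k) :
    X i ∈ L.screen p := by
  have h : L.df p (X i) ∈ (L.screen p).map (L.df p) := by
    rw [← hX.2]
    exact Submodule.subset_span ⟨i, rfl⟩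
  obtain ⟨y, hy, hyx⟩ := h
  exact L.immersion p hyx ▸ hy

/-- `trace(A_W)|_{S(TM)} = ∑ εᵢ g(Xᵢ, A_W Xᵢ)` for an orthonormal basis `(Xᵢ)` of `S(TM)`. -/
theorem screenTraceShape_eq_sum (L : LightlikeSubmanifold g m M)
    (W : ∀ q : M, TangentSpace (𝓡 d) (L.f q)) {p : M} {k : ℕ}
    {X : Fin k → TangentSpace (𝓡 m) p}
    (hX : L.IsOrthonormalBasisOf p (fun i ↦ L.df p (X i)) ((L.screen p).map (L.df p))) :
    L.screenTraceShape nabla W p = ∑ i, g.inner (L.f p) (L.df p (X i)) (L.df p (X i)) *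
      g.inner (L.f p) (L.df p (X i)) (L.df p (L.shapeOp nabla W p (X i))) := by
  have hmem := mem_screen_of_isBasisOf hX.1
  have hli : LinearIndependent ℝ fun i ↦ (⟨X i, hmem i⟩ : L.screen p) := by
    refine LinearIndependent.of_comp (L.df p ∘ₗ (L.screen p).subtype) ?_
    exact hX.1.1
  have hspan : ⊤ ≤ Submodule.span ℝ (Set.range fun i ↦ (⟨X i, hmem i⟩ : L.screen p)) := by
    intro y _
    have hy : L.df p y ∈ Submodule.span ℝ (Set.range fun i ↦ L.df p (X i)) := by
      rw [hX.1.2]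
      exact Submodule.mem_map_of_mem y.2
    obtain ⟨c, hc⟩ := (Submodule.mem_span_range_iff_exists_fun ℝ).1 hy
    refine (Submodule.mem_span_range_iff_exists_fun ℝ).2 ⟨c, Subtype.ext (L.immersion p ?_)⟩
    rw [← hc]
    simp
  let B : L.screen p →ₗ[ℝ] L.screen p →ₗ[ℝ] ℝ :=
    LinearMap.mk₂ ℝ (fun x y ↦ g.inner (L.f p) (L.df p x) (L.df p y))
      (by intros; simp) (by intros; simp) (by intros; simp) (by intros; simp)
  have h := trace_eq_sum_of_orthonormal B (Module.Basis.mk hli hspan)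
    (fun i j hij ↦ by simpa [B] using hX.2.1 i j hij)
    (fun i ↦ by rcases hX.2.2 i with h | h <;> simp [B] <;> simp [h])
    ((L.screen p).projectionOnto _ (L.isCompl_screen p) ∘ₗ L.shapeOp nabla W p ∘ₗ
      (L.screen p).subtype)
  refine h.trans (Finset.sum_congr rfl fun i _ ↦ ?_)
  -- Projecting to the screen changes a tangent vector by a radical one, which the induced metric
  -- does not see.
  have hproj : ∀ v : TangentSpace (𝓡 m) p, g.inner (L.f p) (L.df p (X i))
      (L.df p ((L.screen p).projectionOnto _ (L.isCompl_screen p) v)) =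
      g.inner (L.f p) (L.df p (X i)) (L.df p v) := by
    intro v
    have hv : v - (L.screen p).projectionOnto _ (L.isCompl_screen p) v ∈ L.rad p := by
      rw [← Submodule.projectionOnto_apply_eq_zero_iff (L.isCompl_screen p), map_sub,
        Submodule.projectionOnto_apply_left, sub_self]
    have h := L.inner_df_rad p (X i) hv
    rw [map_sub, map_sub, sub_eq_zero] at h
    exact h.symm
  simp only [Module.Basis.mk_apply, B, LinearMap.mk₂_apply, LinearMap.comp_apply,
    Submodule.subtype_apply, hproj]

/-- A lightlike submanifold which is irrotational, whose induced connection is metric and whose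
screen shape operators are trace-free on `S(TM)`, is minimal. -/
theorem isMinimal_of_irrotational (hLC : IsLeviCivita g nabla) {L : LightlikeSubmanifold g m M}
    (hI : L.IsIrrotational nabla) (hmetric : L.InducedCovIsMetric nabla)
    (htrace : L.ScreenTraceFree nabla) : L.IsMinimal nabla where
  screenSecondForm_radical U hU E hE hE' p hp x _ := by
    rw [screenSecondForm, hI.secondForm_eq_zero hU hE hE' hp x, map_zero]
  trace_secondForm U hU k X hX p hp hXp := by
    refine L.eq_zero_of_mem_tr p (Submodule.sum_mem _ fun i _ ↦
      Submodule.smul_mem _ _ (L.secondForm_mem_tr _ _ _)) (fun e he ↦ ?_) fun w hw ↦ ?_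
    · rw [map_sum]
      exact Finset.sum_eq_zero fun i _ ↦ by
        rw [map_smul, inner_rad_secondForm hLC hI hmetric hU (hX i) hp _ he, smul_zero]
    -- Trace-freeness is available only for the members of one particular frame, so the pairing with
    -- a general `w` is reduced to them by linearity.
    · obtain ⟨V, hV, hpV, l, W, hW, hW'⟩ := htrace p
      rw [← (hW.2 p hpV).1.2] at hw
      induction hw using Submodule.span_induction with
      | zero => exact map_zero _
      | add v w _ _ hv hw => rw [map_add, hv, hw, add_zero]
      | smul c v _ hv => rw [map_smul, hv, smul_zero]
      | mem v hv =>
        obtain ⟨α, rfl⟩ := hv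
        have hmem : ∀ q ∈ V, W α q ∈ L.screenTr q := fun q hq ↦ by
          rw [← (hW.2 q hq).1.2]
          exact Submodule.subset_span ⟨α, rfl⟩
        rw [← hW' p hpV α, L.screenTraceShape_eq_sum (W α) hXp, map_sum,
          sum_apply]
        refine Finset.sum_congr rfl fun i _ ↦ ?_
        rw [map_smul, smul_apply, smul_eq_mul,
          inner_secondForm_screenTr hLC L (hU.inter hV) ((hX i).mono Set.inter_subset_left)
            ((hW.1 α).mono Set.inter_subset_right) (fun q hq ↦ hmem q hq.2) ⟨hp, hpV⟩
            (mem_screen_of_isBasisOf hXp.1 i)]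

end LightlikeSubmanifold

end LightlikeGeometry

open LightlikeGeometry in
theorem mainTheorem1 {n m : ℕ}
    -- the ambient indefinite nearly `μ`-Sasakian manifold
    {A : Type*} [TopologicalSpace A] [ChartedSpace (Model (2 * n + 1)) A]
    [IsManifold (𝓡 (2 * n + 1)) ∞ A]
    (g : SemiRiemannianMetric (2 * n + 1) A) (S : AlmostContactMetric g)
    (nabla : CovariantDerivative (𝓡 (2 * n + 1)) (Model (2 * n + 1))
      (TangentSpace (𝓡 (2 * n + 1)) : A → Type _))
    (hLC : IsLeviCivita g nabla) (μ : ℝ) (hμ : IsNearlySasakian S nabla μ)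
    -- the irrotational ascreen QGCR-lightlike submanifold
    {M : Type*} [TopologicalSpace M] [ChartedSpace (Model m) M] [IsManifold (𝓡 m) ∞ M]
    (L : LightlikeSubmanifold g m M) (hQ : L.IsQGCR S) (hA : L.IsAscreen S)
    (hI : L.IsIrrotational nabla)
    (hmetric : L.InducedCovIsMetric nabla)
    (htrace : L.ScreenTraceFree nabla) :
    L.IsMinimal nabla :=
  LightlikeSubmanifold.isMinimal_of_irrotational hLC hI hmetric htrace
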